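/- Let $M$ be a smooth (Hausdorff) manifold of dimension $2n+1$ carrying a Kenmotsu structure $(\phi,\xi,\eta,g)$. That is, $g$ is a Riemannian metric, $\phi$ a $(1,1)$-tensor field, $\xi$ a vector field and $\eta$ a $1$-form, all smooth, such that $$\phi^2=-I+\eta\otimes\xi,\quad \eta(\xi)=1,\quad \eta=g(\xi,\cdot),\quad g(\phi\,\cdot,\phi\,\cdot)=g-\eta\otimes\eta,$$ and the Levi-Civita connection $\nabla$ of $g$ satisfies $(\nabla_X\phi)Y=g(\phi X,Y)\xi-\eta(Y)\phi X$ for all smooth vector fields $X,Y$. Let $a>0$ be a real constant and let $$\overline\phi=\phi,\quad \overline\xi=\tfrac1a\xi,\quad \overline\eta=a\eta,\quad \overline g=ag+a(a-1)\eta\otimes\eta$$ be the $D$-homothetically deformed structure, which is again an almost contact metric structure. Write $\overline\nabla$, $\overline{\mathrm{div}}$, $\overline{\mathrm{grad}}$, $\overline{\mathrm{Hess}}$, $\overline\Delta$ for the Levi-Civita connection, divergence, gradient, Hessian and Laplace operator of $\overline g$, and $\mathrm{div}$, $\mathrm{grad}$, $\mathrm{Hess}$, $\Delta$ for those of $g$,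 where $\mathrm{div}\,V=\mathrm{tr}(\nabla V)$, $g(\mathrm{grad} f,\cdot)=df$, $\mathrm{Hess}(f)(X,Y)=g(\nabla_X\mathrm{grad} f,Y)$ and $\Delta f=\mathrm{div}(\mathrm{grad} f)$. Then, for all smooth vector fields $X,Y$, $$(\overline\nabla_X\overline\phi)Y=\tfrac1a g(\phi X,Y)\xi-\eta(Y)\phi X,\qquad \overline\nabla\,\overline\xi=\tfrac1a(I-\eta\otimes\xi),$$ $$\pounds_{\overline\xi}\,\overline g=2(g-\eta\otimes\eta),\qquad \overline{\mathrm{div}}(\overline\xi)=\tfrac{2n}{a}.$$ Moreover, for every smooth function $f$ on $M$ and every smooth vector field $V$ on $M$, $$\overline{\mathrm{Hess}}(f)=\mathrm{Hess}(f)-\tfrac{a-1}{a}\,\xi(f)\,(g-\eta\otimes\eta),$$ $$\overline{\mathrm{grad}}(f)=\tfrac1a\,\mathrm{grad}(f)-\tfrac{a-1}{a^2}\,\xi(f)\,\xi,\qquad \overline{\mathrm{div}}(V)=\mathrm{div}(V),$$ $$\overline\Delta(f)=\tfrac1a\Delta(f)-\tfrac{2n(a-1)}{a^2}\,\xi(f)-\tfrac{a-1}{a^2}\,\xi(\xi(f)).$$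 -/

import Mathlib

open Bundle VectorField
open scoped Manifold ContDiff

noncomputable section


namespace ContactGeom

variable {E : Type*} [NormedAddCommGroup E] [NormedSpace ℝ E]
  {H : Type*} [TopologicalSpace H] {I : ModelWithCorners ℝ E H}
  {M : Type*} [TopologicalSpace M] [ChartedSpace H M] [IsManifold I ∞ M]

variable (I M) in
/-- Smooth Riemannian metrics on `M`. -/
abbrev RiemMetric := ContMDiffRiemannianMetric I ∞ E (TangentSpace I : M → Type _)

/-- The (twice) Koszul expression whose value is `2 g(∇_X Y, Z)`. -/
def koszul (g : RiemMetric I M) (X Y Z : Π x : M, TangentSpace I x) (x : M) : ℝ :=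
  mvfderiv I (fun y ↦ g.inner y (Y y) (Z y)) x (X x)
    + mvfderiv I (fun y ↦ g.inner y (X y) (Z y)) x (Y x)
    - mvfderiv I (fun y ↦ g.inner y (X y) (Y y)) x (Z x)
    + g.inner x (mlieBracket I X Y x) (Z x)
    - g.inner x (mlieBracket I X Z x) (Y x)
    - g.inner x (mlieBracket I Y Z x) (X x)

theorem mdiffAt_inner (g : RiemMetric I M) {X Y : Π x : M, TangentSpace I x} {x : M}
    (hX : MDiffAt (T% X) x) (hY : MDiffAt (T% Y) x) :
    MDiffAt (fun y ↦ g.inner y (X y) (Y y)) x := by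
  have h : MDifferentiableAt I (I.prod 𝓘(ℝ))
      (fun m ↦ TotalSpace.mk' ℝ (E := Bundle.Trivial M ℝ) m (g.inner m (X m) (Y m))) x :=
    MDifferentiableAt.clm_bundle_apply₂ (F₁ := E) (F₂ := E)
      (g.contMDiff.mdifferentiableAt (by simp)) hX hY
  simp only [mdifferentiableAt_totalSpace] at h
  exact h.2

variable [FiniteDimensional ℝ E]

theorem koszul_tensorial_left (g : RiemMetric I M) {Y Z : Π x : M, TangentSpace I x} {x : M}
    (hY : MDiffAt (T% Y) x) (hZ : MDiffAt (T% Z) x) :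
    TensorialAt I E (fun X ↦ koszul g X Y Z x) x where
  smul {f X} hf hX := by
    have h1 := mvfderiv_fun_mul hf (mdiffAt_inner g hX hZ)
    have h2 := mvfderiv_fun_mul hf (mdiffAt_inner g hX hY)
    simp [koszul, mlieBracket_smul_left hf hX, h1, h2]
    ring
  add {X X'} hX hX' := by
    have h1 := mvfderiv_fun_add (mdiffAt_inner g hX hZ) (mdiffAt_inner g hX' hZ)
    have h2 := mvfderiv_fun_add (mdiffAt_inner g hX hY) (mdiffAt_inner g hX' hY)
    simp [koszul, mlieBracket_add_left hX hX', h1, h2]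
    ring

theorem koszul_tensorial_right (g : RiemMetric I M) {X Y : Π x : M, TangentSpace I x} {x : M}
    (hX : MDiffAt (T% X) x) (hY : MDiffAt (T% Y) x) :
    TensorialAt I E (fun Z ↦ koszul g X Y Z x) x where
  smul {f Z} hf hZ := by
    have h1 := mvfderiv_fun_mul hf (mdiffAt_inner g hY hZ)
    have h2 := mvfderiv_fun_mul hf (mdiffAt_inner g hX hZ)
    simp [koszul, mlieBracket_smul_right hf hZ, h1, h2, g.symm x (Z x)]
    ring
  add {Z Z'} hZ hZ' := by
    have h1 := mvfderiv_fun_add (mdiffAt_inner g hY hZ) (mdiffAt_inner g hY hZ')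
    have h2 := mvfderiv_fun_add (mdiffAt_inner g hX hZ) (mdiffAt_inner g hX hZ')
    simp [koszul, mlieBracket_add_right hZ hZ', h1, h2]
    ring

instance tangentSpace_finiteDimensional (x : M) : FiniteDimensional ℝ (TangentSpace I x) :=
  inferInstanceAs (FiniteDimensional ℝ E)

instance tangentSpace_t2Space (x : M) : T2Space (TangentSpace I x) :=
  inferInstanceAs (T2Space E)

/-- The musical isomorphism `♭ : T_x M ≃ T_x^* M`, `v ↦ g(v, ·)`. -/
def flat (g : RiemMetric I M) (x : M) :
    TangentSpace I x ≃L[ℝ] (TangentSpace I x →L[ℝ] ℝ) :=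
  (LinearEquiv.ofInjectiveOfFinrankEq (g.inner x : TangentSpace I x →ₗ[ℝ] _)
    (by
      rw [injective_iff_map_eq_zero]
      intro v hv
      by_contra hne
      have h := g.pos x v hne
      have h' : g.inner x v = 0 := hv
      simp [h'] at h)
    (by
      rw [← LinearEquiv.finrank_eq
        (LinearMap.toContinuousLinearMap (𝕜 := ℝ) (E := TangentSpace I x) (F' := ℝ))]
      exact (Subspace.dual_finrank_eq (K := ℝ) (V := TangentSpace I x)).symm)
    ).toContinuousLinearEquiv

theorem flat_apply (g : RiemMetric I M) (x : M) (v w : TangentSpace I x) :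
    flat g x v w = g.inner x v w := rfl

theorem inner_flat_symm (g : RiemMetric I M) (x : M) (α : TangentSpace I x →L[ℝ] ℝ)
    (w : TangentSpace I x) : g.inner x ((flat g x).symm α) w = α w := by
  rw [← flat_apply, ContinuousLinearEquiv.apply_symm_apply]

theorem eq_of_inner (g : RiemMetric I M) {x : M} {v v' : TangentSpace I x}
    (h : ∀ Z : Π x : M, TangentSpace I x, MDiffAt (T% Z) x →
      g.inner x v (Z x) = g.inner x v' (Z x)) : v = v' := by
  apply (flat g x).injective
  ext w
  have := h (FiberBundle.extend E w) (FiberBundle.mdifferentiableAt_extend ..)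
  simpa [flat_apply] using this

open Classical in
/-- `∇_v Y` at `x`, determined by the Koszul formula `2 g(∇_X Y, Z) = koszul g X Y Z`
(and set to `0` where `Y` is not differentiable). -/
def leviCivitaFun (g : RiemMetric I M) (Y : Π x : M, TangentSpace I x) (x : M) :
    TangentSpace I x →L[ℝ] TangentSpace I x :=
  if hY : MDiffAt (T% Y) x then
    (1 / 2 : ℝ) • ((flat g x).symm : (TangentSpace I x →L[ℝ] ℝ) →L[ℝ] TangentSpace I x) ∘L
      TensorialAt.mkHom₂ (I := I) (F := E) (F' := E) (fun X Z ↦ koszul g X Y Z x) x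
        (fun _ hZ ↦ koszul_tensorial_left g hY hZ) (fun _ hX ↦ koszul_tensorial_right g hX hY)
  else 0

theorem inner_leviCivitaFun (g : RiemMetric I M) {X Y Z : Π x : M, TangentSpace I x} {x : M}
    (hX : MDiffAt (T% X) x) (hY : MDiffAt (T% Y) x) (hZ : MDiffAt (T% Z) x) :
    g.inner x (leviCivitaFun g Y x (X x)) (Z x) = 1 / 2 * koszul g X Y Z x := by
  have h := TensorialAt.mkHom₂_apply (I := I) (F := E) (F' := E)
    (Φ := fun X Z ↦ koszul g X Y Z x)
    (fun _ hZ ↦ koszul_tensorial_left g hY hZ) (fun _ hX ↦ koszul_tensorial_right g hX hY) hX hZ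
  simp [leviCivitaFun, hY, inner_flat_symm, h]

theorem koszul_add_middle (g : RiemMetric I M) {X Y Y' Z : Π x : M, TangentSpace I x} {x : M}
    (hX : MDiffAt (T% X) x) (hY : MDiffAt (T% Y) x) (hY' : MDiffAt (T% Y') x)
    (hZ : MDiffAt (T% Z) x) :
    koszul g X (Y + Y') Z x = koszul g X Y Z x + koszul g X Y' Z x := by
  have h1 := mvfderiv_fun_add (mdiffAt_inner g hY hZ) (mdiffAt_inner g hY' hZ)
  have h2 := mvfderiv_fun_add (mdiffAt_inner g hX hY) (mdiffAt_inner g hX hY')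
  simp [koszul, mlieBracket_add_right hY hY', mlieBracket_add_left hY hY', h1, h2]
  ring

theorem koszul_smul_middle (g : RiemMetric I M) {X Y Z : Π x : M, TangentSpace I x} {x : M}
    {f : M → ℝ} (hf : MDiffAt f x)
    (hX : MDiffAt (T% X) x) (hY : MDiffAt (T% Y) x) (hZ : MDiffAt (T% Z) x) :
    koszul g X (f • Y) Z x =
      f x * koszul g X Y Z x + 2 * (mvfderiv I f x (X x) * g.inner x (Y x) (Z x)) := by
  have h1 := mvfderiv_fun_mul hf (mdiffAt_inner g hY hZ)
  have h2 := mvfderiv_fun_mul hf (mdiffAt_inner g hX hY)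
  simp [koszul, mlieBracket_smul_right hf hY, mlieBracket_smul_left hf hY, h1, h2,
    g.symm x (Y x) (X x)]
  ring

/-- The Levi-Civita connection of `g`; `leviCivita g Y x v` is `∇_v Y` at `x`. -/
def leviCivita (g : RiemMetric I M) : CovariantDerivative I E (TangentSpace I : M → Type _) where
  toFun := leviCivitaFun g
  isCovariantDerivativeOnUniv :=
    { add := by
        intro Y Y' x hY hY' _
        have hs : MDiffAt (T% (Y + Y')) x := mdifferentiableAt_add_section hY hY'
        ext v
        refine eq_of_inner g fun Z hZ ↦ ?_
        have hv : v = FiberBundle.extend E v x := by simp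
        have hX := FiberBundle.mdifferentiableAt_extend I E v
        rw [hv, _root_.add_apply, map_add, _root_.add_apply,
          inner_leviCivitaFun g hX hs hZ, inner_leviCivitaFun g hX hY hZ,
          inner_leviCivitaFun g hX hY' hZ, koszul_add_middle g hX hY hY' hZ]
        ring
      leibniz := by
        intro Y f x hY hf _
        have hs : MDiffAt (T% (f • Y)) x := hf.smul_section hY
        ext v
        refine eq_of_inner g fun Z hZ ↦ ?_
        have hv : v = FiberBundle.extend E v x := by simp
        have hX := FiberBundle.mdifferentiableAt_extend I E v
        rw [hv, inner_leviCivitaFun g hX hs hZ, koszul_smul_middle g hf hX hY hZ]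
        simp only [_root_.add_apply, _root_.smul_apply, map_add, map_smul,
          ContinuousLinearMap.smulRight_apply, smul_eq_mul]
        rw [inner_leviCivitaFun g hX hY hZ]
        ring }

/-- The Levi-Civita connection is compatible with the metric. -/
theorem leviCivita_metric (g : RiemMetric I M) {X Y Z : Π x : M, TangentSpace I x} {x : M}
    (hX : MDiffAt (T% X) x) (hY : MDiffAt (T% Y) x) (hZ : MDiffAt (T% Z) x) :
    mvfderiv I (fun y ↦ g.inner y (Y y) (Z y)) x (X x) =
      g.inner x (leviCivita g Y x (X x)) (Z x) + g.inner x (Y x) (leviCivita g Z x (X x)) := by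
  have e1 : g.inner x (leviCivita g Y x (X x)) (Z x) = _ := inner_leviCivitaFun g hX hY hZ
  have e2 : g.inner x (leviCivita g Z x (X x)) (Y x) = _ := inner_leviCivitaFun g hX hZ hY
  have e3 : (fun y ↦ g.inner y (Y y) (Z y)) = (fun y ↦ g.inner y (Z y) (Y y)) :=
    funext fun y ↦ g.symm y _ _
  rw [g.symm x (Y x), e1, e2, koszul, koszul, e3, mlieBracket_swap_apply (V := Z) (W := Y)]
  simp
  ring

/-- The Levi-Civita connection is torsion-free. -/
theorem leviCivita_torsion (g : RiemMetric I M) : (leviCivita g).torsion = 0 := by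
  rw [CovariantDerivative.torsion_eq_zero_iff]
  intro X Y x hX hY
  refine eq_of_inner g fun Z hZ ↦ ?_
  have e1 : g.inner x (leviCivita g Y x (X x)) (Z x) = _ := inner_leviCivitaFun g hX hY hZ
  have e2 : g.inner x (leviCivita g X x (Y x)) (Z x) = _ := inner_leviCivitaFun g hY hX hZ
  have e3 : (fun y ↦ g.inner y (Y y) (X y)) = (fun y ↦ g.inner y (X y) (Y y)) :=
    funext fun y ↦ g.symm y _ _
  rw [map_sub, _root_.sub_apply, e1, e2, koszul, koszul, e3,
    mlieBracket_swap_apply (V := Y) (W := X)]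
  simp
  ring

/-- The directional derivative `X(f)`. -/
def dirDeriv (X : Π x : M, TangentSpace I x) (f : M → ℝ) (x : M) : ℝ :=
  mvfderiv I f x (X x)

/-- `((∇_X φ) Y)_x = (∇_X (φ Y))_x - φ (∇_X Y)_x`, for a `(1,1)`-tensor field `φ` and the
Levi-Civita connection `∇` of `g`. -/
def covDerivEnd (g : RiemMetric I M) (φ : Π x : M, TangentSpace I x →L[ℝ] TangentSpace I x)
    (X Y : Π x : M, TangentSpace I x) (x : M) : TangentSpace I x :=
  leviCivita g (fun y ↦ φ y (Y y)) x (X x) - φ x (leviCivita g Y x (X x))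

/-- The Lie derivative of the metric:
`(£_V g)(X, Y) = V(g(X, Y)) - g([V, X], Y) - g(X, [V, Y])`. -/
def lieDerivMetric (g : RiemMetric I M) (V X Y : Π x : M, TangentSpace I x) (x : M) : ℝ :=
  dirDeriv V (fun y ↦ g.inner y (X y) (Y y)) x
    - g.inner x (mlieBracket I V X x) (Y x) - g.inner x (X x) (mlieBracket I V Y x)

/-- The divergence `div V = tr(v ↦ ∇_v V)`. -/
def divergence (g : RiemMetric I M) (V : Π x : M, TangentSpace I x) (x : M) : ℝ :=
  LinearMap.trace ℝ (TangentSpace I x) (leviCivita g V x).toLinearMap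

/-- The gradient, `g(grad f, v) = df(v)`. -/
def grad (g : RiemMetric I M) (f : M → ℝ) (x : M) : TangentSpace I x :=
  (flat g x).symm (mvfderiv I f x)

/-- The Hessian `Hess f (v, w) = g(∇_v grad f, w)`. -/
def hessian (g : RiemMetric I M) (f : M → ℝ) (x : M) (v w : TangentSpace I x) : ℝ :=
  g.inner x (leviCivita g (grad g f) x v) w

/-- The Laplace operator `Δ f = div (grad f)`. -/
def laplacian (g : RiemMetric I M) (f : M → ℝ) (x : M) : ℝ :=
  divergence g (grad g f) x

variable (I M) in
/-- Smooth vector fields on `M`. -/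
abbrev VField := Cₛ^∞⟮I; E, (TangentSpace I : M → Type _)⟯

variable (I M) in
/-- Smooth `1`-forms on `M`. -/
abbrev OneForm := Cₛ^∞⟮I; E →L[ℝ] ℝ, fun x : M ↦ TangentSpace I x →L[ℝ] ℝ⟯

variable (I M) in
/-- Smooth `(1,1)`-tensor fields on `M`. -/
abbrev EndField := Cₛ^∞⟮I; E →L[ℝ] E, fun x : M ↦ TangentSpace I x →L[ℝ] TangentSpace I x⟯

variable (I M) in
/-- An almost contact metric structure `(φ, ξ, η, g)` on `M`. -/
structure AlmostContactMetric where
  φ : EndField I M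
  ξ : VField I M
  η : OneForm I M
  g : RiemMetric I M
  φ_φ (x : M) (v : TangentSpace I x) : φ x (φ x v) = -v + η x v • ξ x
  η_ξ (x : M) : η x (ξ x) = 1
  η_eq (x : M) (v : TangentSpace I x) : η x v = g.inner x (ξ x) v
  g_φ (x : M) (v w : TangentSpace I x) :
    g.inner x (φ x v) (φ x w) = g.inner x v w - η x v * η x w

namespace AlmostContactMetric

/-- The Kenmotsu condition `(∇_X φ) Y = g(φ X, Y) ξ - η(Y) φ X`. -/
def IsKenmotsu (S : AlmostContactMetric I M) : Prop :=
  ∀ (X Y : VField I M) (x : M),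
    covDerivEnd S.g S.φ X Y x =
      S.g.inner x (S.φ x (X x)) (Y x) • S.ξ x - S.η x (Y x) • S.φ x (X x)

theorem φ_ξ (S : AlmostContactMetric I M) (x : M) : S.φ x (S.ξ x) = 0 := by
  by_contra h
  have h1 := S.g.pos x _ h
  rw [S.g_φ, S.η_ξ, ← S.η_eq, S.η_ξ] at h1
  norm_num at h1

theorem η_φ (S : AlmostContactMetric I M) (x : M) (v : TangentSpace I x) :
    S.η x (S.φ x v) = 0 := by
  have h := S.φ_φ x (S.φ x v)
  rw [S.φ_φ x v, map_add, map_neg, map_smul, φ_ξ, smul_zero, add_zero] at h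
  have h2 := congrArg (fun w ↦ S.η x w) h
  simp [S.η_ξ] at h2
  exact h2

theorem η_sq_le (S : AlmostContactMetric I M) (x : M) (v : TangentSpace I x) :
    S.η x v * S.η x v ≤ S.g.inner x v v := by
  have h := S.g_φ x v v
  by_cases h0 : S.φ x v = 0
  · simp [h0] at h
    linarith
  · have := S.g.pos x _ h0
    linarith

/-- The bilinear form `a g + a (a - 1) η ⊗ η` on `T_x M`. -/
def deformInner (S : AlmostContactMetric I M) (a : ℝ) (x : M) :
    TangentSpace I x →L[ℝ] TangentSpace I x →L[ℝ] ℝ :=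
  a • S.g.inner x + (a * (a - 1)) •
    (S.η x).smulRight (S.η x)

theorem deformInner_apply (S : AlmostContactMetric I M) (a : ℝ) (x : M) (v w : TangentSpace I x) :
    S.deformInner a x v w =
      a * S.g.inner x v w + a * (a - 1) * (S.η x v * S.η x w) := by
  simp [deformInner]

theorem le_deformInner (S : AlmostContactMetric I M) {a : ℝ} (ha : 0 < a) (x : M)
    (v : TangentSpace I x) :
    min a (a ^ 2) * S.g.inner x v v ≤ S.deformInner a x v v := by
  rw [deformInner_apply]
  have h := S.η_sq_le x v
  have h0 := mul_self_nonneg (S.η x v)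
  set e : ℝ := S.η x v * S.η x v
  rcases le_total 1 a with h1 | h1
  · have : min a (a ^ 2) ≤ a := min_le_left _ _
    have h2 : 0 ≤ a * (a - 1) := by nlinarith
    nlinarith [mul_nonneg h2 h0]
  · have : min a (a ^ 2) ≤ a ^ 2 := min_le_right _ _
    have h2 : 0 ≤ a * (1 - a) := by nlinarith
    nlinarith [mul_nonneg h2 (sub_nonneg.2 h)]

theorem contMDiff_deformInner (S : AlmostContactMetric I M) (a : ℝ) :
    ContMDiff I (I.prod 𝓘(ℝ, E →L[ℝ] E →L[ℝ] ℝ)) ∞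
      (fun x ↦ TotalSpace.mk' (E →L[ℝ] E →L[ℝ] ℝ) x (S.deformInner a x)) := by
  have h : ContMDiff I (I.prod 𝓘(ℝ, E →L[ℝ] E →L[ℝ] ℝ)) ∞
      (fun x ↦ TotalSpace.mk' (E →L[ℝ] E →L[ℝ] ℝ)
        (E := fun x : M ↦ TangentSpace I x →L[ℝ] TangentSpace I x →L[ℝ] ℝ) x
        ((S.η x).smulRight (S.η x))) := by
    intro x₀
    have hη := ((contMDiffAt_hom_bundle _).1 (S.η.contMDiff x₀)).2
    refine (contMDiffAt_hom_bundle _).2 ⟨contMDiffAt_id, ?_⟩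
    have hc : ContDiff ℝ ∞ (fun L : E →L[ℝ] ℝ ↦ L.smulRight L) :=
      contDiff_id.smulRight contDiff_id
    refine (hc.contMDiff.contMDiffAt.comp x₀ hη).congr_of_eventuallyEq ?_
    have hb : ∀ᶠ x in nhds x₀, x ∈ (trivializationAt E (TangentSpace I) x₀).baseSet :=
      (trivializationAt E (TangentSpace I) x₀).open_baseSet.mem_nhds
        (FiberBundle.mem_baseSet_trivializationAt' x₀)
    filter_upwards [hb] with x hx
    ext v w
    rw [inCoordinates_apply_eq₂ hx hx (by simp)]
    simp [ContinuousLinearMap.inCoordinates, Trivialization.symmL_apply _ hx]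
  exact (S.g.contMDiff.const_smul_section (a := a)).add_section
    (h.const_smul_section (a := a * (a - 1)))

/-- The deformed metric `a g + a (a - 1) η ⊗ η`. -/
def deformMetric (S : AlmostContactMetric I M) (a : ℝ) (ha : 0 < a) : RiemMetric I M where
  inner := S.deformInner a
  symm x v w := by
    rw [deformInner_apply, deformInner_apply, S.g.symm x v w]
    ring
  pos x v hv := lt_of_lt_of_le (mul_pos (lt_min ha (by positivity)) (S.g.pos x v hv))
    (S.le_deformInner ha x v)
  isVonNBounded x := by
    set c := min a (a ^ 2) with hc
    have hc0 : 0 < c := lt_min ha (by positivity)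
    have h := (S.g.isVonNBounded x).image
      ((Real.sqrt c)⁻¹ • ContinuousLinearMap.id ℝ (TangentSpace I x))
    refine h.subset ?_
    intro v hv
    refine ⟨Real.sqrt c • v, ?_, ?_⟩
    · have h1 := S.le_deformInner ha x v
      have h2 : S.deformInner a x v v < 1 := hv
      have h3 := Real.mul_self_sqrt hc0.le
      change S.g.inner x (Real.sqrt c • v) (Real.sqrt c • v) < 1
      simp only [map_smul, _root_.smul_apply, smul_eq_mul, ← mul_assoc, h3]
      linarith
    · simp [smul_smul, (Real.sqrt_pos.2 hc0).ne']
  contMDiff := S.contMDiff_deformInner a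

/-- The `D`-homothetic deformation
`φ' = φ`, `ξ' = (1/a) ξ`, `η' = a η`, `g' = a g + a (a - 1) η ⊗ η`. -/
def deform (S : AlmostContactMetric I M) (a : ℝ) (ha : 0 < a) : AlmostContactMetric I M where
  φ := S.φ
  ξ := (1 / a) • S.ξ
  η := a • S.η
  g := S.deformMetric a ha
  φ_φ x v := by
    change _ = -v + (a * S.η x v) • (1 / a) • S.ξ x
    rw [S.φ_φ, smul_smul]
    congr 2
    field_simp
  η_ξ x := by
    change a * S.η x ((1 / a) • S.ξ x) = 1
    rw [map_smul, S.η_ξ, smul_eq_mul]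
    field_simp
  η_eq x v := by
    change a * S.η x v = S.deformInner a x ((1 / a) • S.ξ x) v
    rw [map_smul, _root_.smul_apply, deformInner_apply, S.η_ξ, ← S.η_eq, smul_eq_mul]
    field_simp
    ring
  g_φ x v w := by
    change S.deformInner a x _ _ = S.deformInner a x _ _ - (a * S.η x v) * (a * S.η x w)
    rw [deformInner_apply, deformInner_apply, S.g_φ, η_φ]
    ring

end AlmostContactMetric

end ContactGeom
end

/-!
Applying the Kenmotsu condition to `Y = ξ` gives `∇ξ = I - η ⊗ ξ`. Hence `η` is closed, which makes
the Koszul formula of the deformed metric collapse to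
`∇'_X Y = ∇_X Y + (a - 1) / a (g(X, Y) - η(X) η(Y)) ξ`. The form `g - η ⊗ η` annihilates `ξ`, so the
correction `X ↦ ∇'_X Y - ∇_X Y` is trace-free and the divergence does not change. The other
formulas are the definitions evaluated with this connection; in particular
`Δ' f = div (grad' f)`, where `grad' f` is a combination of `grad f` and `ξ(f) ξ`.
-/

namespace ContactGeom

section BundleEquiv

variable {𝕜 B F₁ F₂ : Type*} [NontriviallyNormedField 𝕜] {E₁ E₂ : B → Type*}
  [∀ x, AddCommGroup (E₁ x)] [∀ x, Module 𝕜 (E₁ x)] [NormedAddCommGroup F₁] [NormedSpace 𝕜 F₁]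
  [TopologicalSpace (TotalSpace F₁ E₁)] [∀ x, TopologicalSpace (E₁ x)]
  [∀ x, AddCommGroup (E₂ x)] [∀ x, Module 𝕜 (E₂ x)] [NormedAddCommGroup F₂] [NormedSpace 𝕜 F₂]
  [TopologicalSpace (TotalSpace F₂ E₂)] [∀ x, TopologicalSpace (E₂ x)] [TopologicalSpace B]
  [FiberBundle F₁ E₁] [VectorBundle 𝕜 F₁ E₁] [FiberBundle F₂ E₂] [VectorBundle 𝕜 F₂ E₂]

theorem exists_continuousLinearEquiv_inCoordinates_eq {x y : B} (e : E₁ y ≃L[𝕜] E₂ y)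
    (h₁ : y ∈ (trivializationAt F₁ E₁ x).baseSet) (h₂ : y ∈ (trivializationAt F₂ E₂ x).baseSet) :
    ∃ T : F₁ ≃L[𝕜] F₂,
      ContinuousLinearMap.inCoordinates F₁ E₁ F₂ E₂ x y x y (e : E₁ y →L[𝕜] E₂ y) = T ∧
      ContinuousLinearMap.inCoordinates F₂ E₂ F₁ E₁ x y x y (e.symm : E₂ y →L[𝕜] E₁ y) =
        T.symm :=
  ⟨((trivializationAt F₁ E₁ x).continuousLinearEquivAt 𝕜 y h₁).symm.trans
      (e.trans ((trivializationAt F₂ E₂ x).continuousLinearEquivAt 𝕜 y h₂)),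
    ContinuousLinearMap.inCoordinates_eq h₁ h₂, ContinuousLinearMap.inCoordinates_eq h₂ h₁⟩

variable {EB HB : Type*} [NormedAddCommGroup EB] [NormedSpace 𝕜 EB] [TopologicalSpace HB]
  {IB : ModelWithCorners 𝕜 EB HB} [ChartedSpace HB B]
  [∀ x, IsTopologicalAddGroup (E₂ x)] [∀ x, ContinuousSMul 𝕜 (E₂ x)] [CompleteSpace F₁]

theorem mdifferentiableAt_continuousLinearEquiv_symm_apply {e : Π y, E₁ y ≃L[𝕜] E₂ y}
    {s : Π y, E₂ y} {x : B}
    (he : MDifferentiableAt IB (IB.prod 𝓘(𝕜, F₁ →L[𝕜] F₂))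
      (fun y ↦ TotalSpace.mk' (F₁ →L[𝕜] F₂) (E := fun y ↦ E₁ y →L[𝕜] E₂ y) y (e y)) x)
    (hs : MDifferentiableAt IB (IB.prod 𝓘(𝕜, F₂)) (fun y ↦ TotalSpace.mk' F₂ y (s y)) x) :
    MDifferentiableAt IB (IB.prod 𝓘(𝕜, F₁))
      (fun y ↦ TotalSpace.mk' F₁ y ((e y).symm (s y))) x := by
  have h₁ := FiberBundle.mem_baseSet_trivializationAt' (F := F₁) (E := E₁) x
  have h₂ := FiberBundle.mem_baseSet_trivializationAt' (F := F₂) (E := E₂) x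
  have hinv : DifferentiableAt 𝕜 ContinuousLinearMap.inverse
      (ContinuousLinearMap.inCoordinates F₁ E₁ F₂ E₂ x x x x (e x : E₁ x →L[𝕜] E₂ x)) := by
    obtain ⟨T, hT, -⟩ := exists_continuousLinearEquiv_inCoordinates_eq (e x) h₁ h₂
    rw [hT]
    exact (contDiffAt_map_inverse (n := 1) T).differentiableAt one_ne_zero
  refine MDifferentiableAt.clm_apply_of_inCoordinates (b₁ := id) (b₂ := id)
    (ϕ := fun y ↦ ((e y).symm : E₂ y →L[𝕜] E₁ y)) (v := s) ?_ hs mdifferentiableAt_id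
  refine (hinv.mdifferentiableAt.comp x
    ((mdifferentiableAt_hom_bundle _).1 he).2).congr_of_eventuallyEq ?_
  filter_upwards [(trivializationAt F₁ E₁ x).open_baseSet.mem_nhds h₁,
    (trivializationAt F₂ E₂ x).open_baseSet.mem_nhds h₂] with y hy₁ hy₂
  obtain ⟨T, hT, hT'⟩ := exists_continuousLinearEquiv_inCoordinates_eq (e y) hy₁ hy₂
  exact hT'.trans (by rw [Function.comp_apply, hT, ContinuousLinearMap.inverse_equiv])

end BundleEquiv

theorem mdiffAt_mvfderiv {𝕜 E H M F : Type*} [NontriviallyNormedField 𝕜] [NormedAddCommGroup E]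
    [NormedSpace 𝕜 E] [TopologicalSpace H] {I : ModelWithCorners 𝕜 E H} [TopologicalSpace M]
    [ChartedSpace H M] [IsManifold I 2 M] [NormedAddCommGroup F] [NormedSpace 𝕜 F]
    {f : M → F} {x : M} (hf : ContMDiffAt I 𝓘(𝕜, F) 2 f x) :
    MDifferentiableAt I (I.prod 𝓘(𝕜, E →L[𝕜] F))
      (fun y ↦ TotalSpace.mk' (E →L[𝕜] F) (E := fun y : M ↦ TangentSpace I y →L[𝕜] F) y
        (mvfderiv I f y)) x := by
  refine (mdifferentiableAt_hom_bundle _).2 ⟨mdifferentiableAt_id, ?_⟩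
  convert (hf.mfderiv_const (m := 1) (by norm_num)).mdifferentiableAt one_ne_zero using 1
  funext y
  ext v
  simp only [ContinuousLinearMap.inCoordinates, inTangentCoordinates, mvfderiv,
    ContinuousLinearMap.comp_apply, ContinuousLinearEquiv.coe_coe,
    Trivial.fiberBundle_trivializationAt', Trivial.continuousLinearMapAt_trivialization,
    TangentBundle.continuousLinearMapAt_model_space, ContinuousLinearMap.id_comp, id_eq]
  rfl

variable {E : Type*} [NormedAddCommGroup E] [NormedSpace ℝ E]
  {H : Type*} [TopologicalSpace H] {I : ModelWithCorners ℝ E H}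
  {M : Type*} [TopologicalSpace M] [ChartedSpace H M] [IsManifold I ∞ M]

theorem VField.mdiffAt (X : VField I M) (x : M) : MDiffAt (T% (fun y ↦ X y)) x :=
  (X.contMDiff x).mdifferentiableAt (by simp)

theorem EndField.mdiffAt_apply (A : EndField I M) {Y : Π x : M, TangentSpace I x} {x : M}
    (hY : MDiffAt (T% Y) x) : MDiffAt (T% (fun y ↦ A y (Y y))) x :=
  MDifferentiableAt.clm_bundle_apply (F₁ := E) (F₂ := E)
    ((A.contMDiff x).mdifferentiableAt (by simp)) hY

theorem mdiffAt_dirDeriv {f : M → ℝ} {X : Π x : M, TangentSpace I x} {x : M}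
    (hf : ContMDiffAt I 𝓘(ℝ) 2 f x) (hX : MDiffAt (T% X) x) : MDiffAt (dirDeriv X f) x := by
  have h : MDifferentiableAt I (I.prod 𝓘(ℝ))
      (fun y ↦ TotalSpace.mk' ℝ (E := Bundle.Trivial M ℝ) y (dirDeriv X f y)) x :=
    MDifferentiableAt.clm_bundle_apply (F₁ := E) (F₂ := ℝ) (mdiffAt_mvfderiv hf) hX
  exact ((mdifferentiableAt_totalSpace I _).1 h).2

namespace AlmostContactMetric

theorem inner_ξ_right (S : AlmostContactMetric I M) (x : M) (v : TangentSpace I x) :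
    S.g.inner x v (S.ξ x) = S.η x v := by
  rw [S.g.symm, S.η_eq]

theorem mdiffAt_η (S : AlmostContactMetric I M) {Y : Π x : M, TangentSpace I x} {x : M}
    (hY : MDiffAt (T% Y) x) : MDiffAt (fun y ↦ S.η y (Y y)) x := by
  simpa only [S.η_eq] using mdiffAt_inner S.g (S.ξ.mdiffAt x) hY

end AlmostContactMetric

variable [FiniteDimensional ℝ E]

section Extension

variable {F : Type*} [NormedAddCommGroup F] [NormedSpace ℝ F] {V : M → Type*}
  [TopologicalSpace (TotalSpace F V)] [∀ x, AddCommGroup (V x)] [∀ x, Module ℝ (V x)]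
  [∀ x, TopologicalSpace (V x)] [FiberBundle F V] [VectorBundle ℝ F V]
  [ContMDiffVectorBundle ∞ F V I]

theorem exists_contMDiffSection_apply_eq [T2Space M] {x : M} (v : V x) :
    ∃ s : Cₛ^∞⟮I; F, V⟯, s x = v := by
  obtain ⟨t, ht, hsmooth⟩ := FiberBundle.exists_contMDiffOn_extend (k := ∞) I F v
  obtain ⟨u, hut, hu, hxu⟩ := mem_nhds_iff.1 ht
  obtain ⟨ψ, -, hψ⟩ := (SmoothBumpFunction.nhds_basis_tsupport (I := I) x).mem_iff.1
    (hu.mem_nhds hxu)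
  exact ⟨⟨(ψ : M → ℝ) • FiberBundle.extend F v,
    ContMDiffOn.smul_section_of_tsupport ψ.contMDiff.contMDiffOn hu hψ (hsmooth.mono hut)⟩,
    by simp⟩

end Extension

section Metric

variable (g : RiemMetric I M) {X Y Z : Π x : M, TangentSpace I x} {f : M → ℝ} {x : M}

theorem inner_leviCivita (hX : MDiffAt (T% X) x) (hY : MDiffAt (T% Y) x)
    (hZ : MDiffAt (T% Z) x) :
    g.inner x (leviCivita g Y x (X x)) (Z x) = 1 / 2 * koszul g X Y Z x :=
  inner_leviCivitaFun g hX hY hZ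

theorem mvfderiv_inner (v : TangentSpace I x) (hY : MDiffAt (T% Y) x) (hZ : MDiffAt (T% Z) x) :
    mvfderiv I (fun y ↦ g.inner y (Y y) (Z y)) x v =
      g.inner x (leviCivita g Y x v) (Z x) + g.inner x (Y x) (leviCivita g Z x v) := by
  simpa only [FiberBundle.extend_apply_self] using
    leviCivita_metric g (FiberBundle.mdifferentiableAt_extend I E v) hY hZ

theorem leviCivita_sub_eq_mlieBracket (hX : MDiffAt (T% X) x) (hY : MDiffAt (T% Y) x) :
    leviCivita g Y x (X x) - leviCivita g X x (Y x) = mlieBracket I X Y x :=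
  (CovariantDerivative.torsion_eq_zero_iff _).1 (leviCivita_torsion g) hX hY

theorem leviCivita_const_smul (c : ℝ) (hY : MDiffAt (T% Y) x) :
    leviCivita g (c • Y) x = c • leviCivita g Y x :=
  (leviCivita g).isCovariantDerivativeOnUniv.smul_const c hY

theorem lieDerivMetric_eq (hX : MDiffAt (T% X) x) (hY : MDiffAt (T% Y) x)
    (hZ : MDiffAt (T% Z) x) :
    lieDerivMetric g X Y Z x =
      g.inner x (leviCivita g X x (Y x)) (Z x) + g.inner x (Y x) (leviCivita g X x (Z x)) := by
  rw [lieDerivMetric, dirDeriv, mvfderiv_inner g _ hY hZ, ← leviCivita_sub_eq_mlieBracket g hX hY,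
    ← leviCivita_sub_eq_mlieBracket g hX hZ]
  simp only [map_sub, _root_.sub_apply]
  ring

theorem inner_grad (f : M → ℝ) (x : M) (v : TangentSpace I x) :
    g.inner x (grad g f x) v = mvfderiv I f x v :=
  inner_flat_symm g x _ v

theorem dirDeriv_eq_inner_grad (X : Π x : M, TangentSpace I x) (f : M → ℝ) :
    dirDeriv X f = fun x ↦ g.inner x (grad g f x) (X x) :=
  funext fun x ↦ (inner_grad g f x (X x)).symm

theorem mdiffAt_grad (hf : ContMDiffAt I 𝓘(ℝ) 2 f x) : MDiffAt (T% (grad g f)) x :=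
  mdifferentiableAt_continuousLinearEquiv_symm_apply (e := flat g)
    ((g.contMDiff x).mdifferentiableAt (by simp)) (mdiffAt_mvfderiv hf)

theorem hessian_apply (hf : ContMDiffAt I 𝓘(ℝ) 2 f x) (hY : MDiffAt (T% Y) x)
    (v : TangentSpace I x) :
    hessian g f x v (Y x) =
      mvfderiv I (dirDeriv Y f) x v - mvfderiv I f x (leviCivita g Y x v) := by
  rw [dirDeriv_eq_inner_grad g, mvfderiv_inner g v (mdiffAt_grad g hf) hY, inner_grad, hessian,
    add_sub_cancel_right]

theorem divergence_add (hX : MDiffAt (T% X) x) (hY : MDiffAt (T% Y) x) :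
    divergence g (X + Y) x = divergence g X x + divergence g Y x := by
  rw [divergence, (leviCivita g).isCovariantDerivativeOnUniv.add hX hY]
  exact map_add ..

theorem divergence_const_smul (c : ℝ) (hX : MDiffAt (T% X) x) :
    divergence g (c • X) x = c * divergence g X x := by
  rw [divergence, leviCivita_const_smul g c hX]
  exact map_smul ..

theorem divergence_smul (hf : MDiffAt f x) (hX : MDiffAt (T% X) x) :
    divergence g (f • X) x = f x * divergence g X x + dirDeriv X f x := by
  rw [divergence, (leviCivita g).isCovariantDerivativeOnUniv.leibniz hX hf]
  refine (map_add ..).trans (congrArg₂ _ (map_smul ..) ?_)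
  exact LinearMap.trace_smulRight ..

end Metric

namespace AlmostContactMetric

variable (S : AlmostContactMetric I M) {X Y Z : Π x : M, TangentSpace I x} {x : M}

theorem inner_φ_right (x : M) (v w : TangentSpace I x) :
    S.g.inner x v (S.φ x w) = -S.g.inner x (S.φ x v) w := by
  have h := S.g_φ x (S.φ x v) w
  rw [S.φ_φ, S.η_φ] at h
  simp only [map_add, map_neg, map_smul, _root_.add_apply, _root_.neg_apply,
    _root_.smul_apply, ← S.η_eq, S.η_φ, smul_eq_mul] at h
  linarith

theorem η_grad (f : M → ℝ) (x : M) : S.η x (grad S.g f x) = dirDeriv S.ξ f x := by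
  rw [S.η_eq, S.g.symm, inner_grad, dirDeriv]

theorem η_leviCivita_ξ (x : M) (v : TangentSpace I x) :
    S.η x (leviCivita S.g S.ξ x v) = 0 := by
  have hξξ := mvfderiv_inner S.g v (S.ξ.mdiffAt x) (S.ξ.mdiffAt x)
  simp only [← S.η_eq, S.η_ξ, S.inner_ξ_right, mvfderiv_const, _root_.zero_apply] at hξξ
  linarith

/-- The characteristic field `ξ` is torse-forming: `∇ξ = I - η ⊗ ξ`. This is the part of the
Kenmotsu condition that does not involve `φ`. -/
def IsTorseForming (S : AlmostContactMetric I M) : Prop :=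
  ∀ (x : M) (v : TangentSpace I x), leviCivita S.g S.ξ x v = v - S.η x v • S.ξ x

variable {S}

theorem IsKenmotsu.isTorseForming [T2Space M] (hS : S.IsKenmotsu) : S.IsTorseForming := by
  intro x v
  obtain ⟨X, rfl⟩ := exists_contMDiffSection_apply_eq (I := I) (F := E) v
  have hφξ : (fun y ↦ S.φ y (S.ξ y)) = (0 : Π y : M, TangentSpace I y) := funext S.φ_ξ
  have h := hS X S.ξ x
  rw [covDerivEnd, hφξ, CovariantDerivative.zero, S.inner_ξ_right, S.η_φ, S.η_ξ] at h
  simp only [Pi.zero_apply, _root_.zero_apply, zero_sub, zero_smul, one_smul, neg_inj] at h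
  have hφ := congrArg (S.φ x) h
  rw [S.φ_φ, S.φ_φ, S.η_leviCivita_ξ, zero_smul, add_zero, neg_eq_iff_eq_neg] at hφ
  rw [hφ]
  abel

namespace IsTorseForming

theorem mvfderiv_η (hS : S.IsTorseForming) (v : TangentSpace I x) (hY : MDiffAt (T% Y) x) :
    mvfderiv I (fun y ↦ S.η y (Y y)) x v =
      S.g.inner x v (Y x) - S.η x v * S.η x (Y x) + S.η x (leviCivita S.g Y x v) := by
  simp only [S.η_eq _ (Y _)]
  rw [mvfderiv_inner S.g v (S.ξ.mdiffAt x) hY, hS]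
  simp only [map_sub, map_smul, _root_.sub_apply, _root_.smul_apply, smul_eq_mul, ← S.η_eq]

theorem η_mlieBracket (hS : S.IsTorseForming) (hX : MDiffAt (T% X) x) (hY : MDiffAt (T% Y) x) :
    S.η x (mlieBracket I X Y x) = mvfderiv I (fun y ↦ S.η y (Y y)) x (X x) -
      mvfderiv I (fun y ↦ S.η y (X y)) x (Y x) := by
  rw [hS.mvfderiv_η _ hX, hS.mvfderiv_η _ hY, ← leviCivita_sub_eq_mlieBracket S.g hX hY, map_sub,
    S.g.symm x (X x)]
  ring

theorem divergence_ξ (hS : S.IsTorseForming) (x : M) :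
    divergence S.g S.ξ x = Module.finrank ℝ E - 1 := by
  have h : (leviCivita S.g S.ξ x).toLinearMap =
      LinearMap.id - (S.η x).toLinearMap.smulRight (S.ξ x) :=
    LinearMap.ext (hS x)
  rw [divergence, h, map_sub, LinearMap.trace_id, LinearMap.trace_smulRight]
  exact congrArg _ (S.η_ξ x)

end IsTorseForming

section Deform

variable (S) {a : ℝ} (ha : 0 < a)

theorem deform_inner (x : M) (v w : TangentSpace I x) :
    (S.deform a ha).g.inner x v w =
      a * S.g.inner x v w + a * (a - 1) * (S.η x v * S.η x w) :=
  S.deformInner_apply a x v w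

theorem deform_inner_ξ (x : M) (v : TangentSpace I x) :
    (S.deform a ha).g.inner x (S.ξ x) v = a ^ 2 * S.η x v := by
  rw [deform_inner, S.η_ξ, ← S.η_eq]
  ring

theorem mvfderiv_deform_inner (v : TangentSpace I x) (hX : MDiffAt (T% X) x)
    (hY : MDiffAt (T% Y) x) :
    mvfderiv I (fun y ↦ (S.deform a ha).g.inner y (X y) (Y y)) x v =
      a * mvfderiv I (fun y ↦ S.g.inner y (X y) (Y y)) x v + a * (a - 1) *
        (S.η x (X x) * mvfderiv I (fun y ↦ S.η y (Y y)) x v +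
          S.η x (Y x) * mvfderiv I (fun y ↦ S.η y (X y)) x v) := by
  have hg := mdiffAt_inner S.g hX hY
  have hηη := (S.mdiffAt_η hX).mul (S.mdiffAt_η hY)
  have hc (c : ℝ) : MDiffAt (fun _ : M ↦ c) x := mdifferentiableAt_const
  have h : (fun y ↦ (S.deform a ha).g.inner y (X y) (Y y)) =
      (fun _ ↦ a) * (fun y ↦ S.g.inner y (X y) (Y y)) +
        (fun _ ↦ a * (a - 1)) * ((fun y ↦ S.η y (X y)) * fun y ↦ S.η y (Y y)) :=
    funext fun y ↦ S.deform_inner ha y (X y) (Y y)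
  rw [h, mvfderiv_add ((hc _).mul hg) ((hc _).mul hηη), mvfderiv_mul (hc _) hg,
    mvfderiv_mul (hc _) hηη, mvfderiv_mul (S.mdiffAt_η hX) (S.mdiffAt_η hY)]
  simp only [mvfderiv_const, smul_zero, add_zero, _root_.add_apply, _root_.smul_apply, smul_eq_mul]

theorem koszul_deform (hX : MDiffAt (T% X) x) (hY : MDiffAt (T% Y) x) (hZ : MDiffAt (T% Z) x)
    (hη : ∀ U V : Π x : M, TangentSpace I x, MDiffAt (T% U) x → MDiffAt (T% V) x →
      S.η x (mlieBracket I U V x) = mvfderiv I (fun y ↦ S.η y (V y)) x (U x) -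
        mvfderiv I (fun y ↦ S.η y (U y)) x (V x)) :
    koszul (S.deform a ha).g X Y Z x = a * koszul S.g X Y Z x +
      2 * (a * (a - 1)) * (mvfderiv I (fun y ↦ S.η y (Y y)) x (X x) * S.η x (Z x)) := by
  rw [koszul, koszul, S.mvfderiv_deform_inner ha _ hY hZ, S.mvfderiv_deform_inner ha _ hX hZ,
    S.mvfderiv_deform_inner ha _ hX hY]
  simp only [deform_inner, hη X Y hX hY, hη X Z hX hZ, hη Y Z hY hZ]
  ring

theorem grad_deform (f : M → ℝ) (x : M) :
    grad (S.deform a ha).g f x = (1 / a) • grad S.g f x -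
      ((a - 1) / a ^ 2 * dirDeriv S.ξ f x) • S.ξ x := by
  refine eq_of_inner (S.deform a ha).g fun Z _ ↦ ?_
  simp only [map_sub, map_smul, _root_.sub_apply, _root_.smul_apply, smul_eq_mul, inner_grad,
    deform_inner_ξ]
  rw [deform_inner, inner_grad, η_grad]
  field_simp
  ring

variable {S}

namespace IsTorseForming

theorem leviCivita_deform (hS : S.IsTorseForming) (v : TangentSpace I x)
    (hY : MDiffAt (T% Y) x) :
    leviCivita (S.deform a ha).g Y x v = leviCivita S.g Y x v +
      ((a - 1) / a * (S.g.inner x v (Y x) - S.η x v * S.η x (Y x))) • S.ξ x := by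
  refine eq_of_inner (S.deform a ha).g fun Z hZ ↦ ?_
  obtain ⟨X, hX, rfl⟩ : ∃ X : Π x : M, TangentSpace I x, MDiffAt (T% X) x ∧ X x = v :=
    ⟨_, FiberBundle.mdifferentiableAt_extend I E v, FiberBundle.extend_apply_self E v⟩
  rw [inner_leviCivita _ hX hY hZ, S.koszul_deform ha hX hY hZ fun U V hU hV ↦
      hS.η_mlieBracket hU hV, hS.mvfderiv_η _ hY, map_add, _root_.add_apply, map_smul,
    _root_.smul_apply, smul_eq_mul, deform_inner_ξ, deform_inner, inner_leviCivita _ hX hY hZ]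
  field_simp
  ring

theorem covDerivEnd_deform (hS : S.IsTorseForming) (X : Π x : M, TangentSpace I x)
    (hY : MDiffAt (T% Y) x) :
    covDerivEnd (S.deform a ha).g (S.deform a ha).φ X Y x =
      covDerivEnd S.g S.φ X Y x + ((a - 1) / a * S.g.inner x (X x) (S.φ x (Y x))) • S.ξ x := by
  change leviCivita (S.deform a ha).g (fun y ↦ S.φ y (Y y)) x (X x) -
    S.φ x (leviCivita (S.deform a ha).g Y x (X x)) = _
  rw [hS.leviCivita_deform ha _ (S.φ.mdiffAt_apply hY), hS.leviCivita_deform ha _ hY, map_add,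
    map_smul, S.φ_ξ, S.η_φ, covDerivEnd]
  module

theorem leviCivita_deform_ξ (hS : S.IsTorseForming) (x : M) (v : TangentSpace I x) :
    leviCivita (S.deform a ha).g S.ξ x v = v - S.η x v • S.ξ x := by
  rw [hS.leviCivita_deform ha v (S.ξ.mdiffAt x), hS, S.inner_ξ_right, S.η_ξ]
  module

theorem leviCivita_deform_deform_ξ (hS : S.IsTorseForming) (x : M) (v : TangentSpace I x) :
    leviCivita (S.deform a ha).g (S.deform a ha).ξ x v = (1 / a) • (v - S.η x v • S.ξ x) := by
  rw [← hS.leviCivita_deform_ξ ha]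
  exact congrArg (· v) (leviCivita_const_smul _ (1 / a) (S.ξ.mdiffAt x))

theorem lieDerivMetric_deform (hS : S.IsTorseForming) (hX : MDiffAt (T% X) x)
    (hY : MDiffAt (T% Y) x) :
    lieDerivMetric (S.deform a ha).g (S.deform a ha).ξ X Y x =
      2 * (S.g.inner x (X x) (Y x) - S.η x (X x) * S.η x (Y x)) := by
  rw [lieDerivMetric_eq _ (VField.mdiffAt _ x) hX hY, hS.leviCivita_deform_deform_ξ,
    hS.leviCivita_deform_deform_ξ]
  simp only [map_smul, map_sub, _root_.smul_apply, _root_.sub_apply, smul_eq_mul, deform_inner,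
    S.η_ξ, ← S.η_eq, S.inner_ξ_right]
  field_simp
  ring

theorem divergence_deform (hS : S.IsTorseForming) (hY : MDiffAt (T% Y) x) :
    divergence (S.deform a ha).g Y x = divergence S.g Y x := by
  have h : (leviCivita (S.deform a ha).g Y x).toLinearMap =
      (leviCivita S.g Y x).toLinearMap + ((a - 1) / a) •
        ((S.g.inner x (Y x) - S.η x (Y x) • S.η x).toLinearMap.smulRight (S.ξ x)) := by
    refine LinearMap.ext fun v ↦ (hS.leviCivita_deform ha v hY).trans ?_
    simp only [LinearMap.add_apply, LinearMap.smul_apply, LinearMap.smulRight_apply,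
      ContinuousLinearMap.coe_coe, _root_.sub_apply, _root_.smul_apply, smul_smul, smul_eq_mul,
      S.g.symm x (Y x), mul_comm (S.η x (Y x))]
  rw [divergence, divergence, h, map_add, map_smul, LinearMap.trace_smulRight]
  simp [S.inner_ξ_right, S.η_ξ]

theorem divergence_deform_ξ (hS : S.IsTorseForming) (x : M) :
    divergence (S.deform a ha).g (S.deform a ha).ξ x = (Module.finrank ℝ E - 1) / a := by
  have hξ := S.ξ.mdiffAt x
  refine (divergence_const_smul _ (1 / a) hξ).trans ?_
  rw [hS.divergence_deform ha hξ, hS.divergence_ξ]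
  ring

theorem hessian_deform (hS : S.IsTorseForming) {f : M → ℝ} (hf : ContMDiffAt I 𝓘(ℝ) 2 f x)
    (v w : TangentSpace I x) :
    hessian (S.deform a ha).g f x v w = hessian S.g f x v w -
      (a - 1) / a * dirDeriv S.ξ f x * (S.g.inner x v w - S.η x v * S.η x w) := by
  obtain ⟨Y, hY, rfl⟩ : ∃ Y : Π x : M, TangentSpace I x, MDiffAt (T% Y) x ∧ Y x = w :=
    ⟨_, FiberBundle.mdifferentiableAt_extend I E w, FiberBundle.extend_apply_self E w⟩
  rw [hessian_apply _ hf hY, hessian_apply _ hf hY, hS.leviCivita_deform ha v hY, map_add, map_smul,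
    dirDeriv, smul_eq_mul]
  ring

theorem laplacian_deform (hS : S.IsTorseForming) {f : M → ℝ} (hf : ContMDiffAt I 𝓘(ℝ) 2 f x) :
    laplacian (S.deform a ha).g f x = (1 / a) * laplacian S.g f x -
      (Module.finrank ℝ E - 1) * (a - 1) / a ^ 2 * dirDeriv S.ξ f x -
      (a - 1) / a ^ 2 * dirDeriv S.ξ (dirDeriv S.ξ f) x := by
  have hξ := S.ξ.mdiffAt x
  have hgrad := mdiffAt_grad S.g hf
  have hξf := mdiffAt_dirDeriv hf hξ
  have hgrad_deform : grad (S.deform a ha).g f =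
      (1 / a) • grad S.g f + (-((a - 1) / a ^ 2)) • (dirDeriv S.ξ f • (S.ξ : Π x, _)) := by
    funext y
    rw [S.grad_deform]
    simp only [Pi.add_apply, Pi.smul_apply, Pi.smul_apply']
    module
  have hgrad' := mdiffAt_grad (S.deform a ha).g hf
  rw [laplacian, hS.divergence_deform ha hgrad', hgrad_deform,
    divergence_add _ (hgrad.smul_const_section) (hξf.smul_section hξ).smul_const_section,
    divergence_const_smul _ _ hgrad, divergence_const_smul _ _ (hξf.smul_section hξ),
    divergence_smul _ hξf hξ, hS.divergence_ξ, laplacian]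
  ring

end IsTorseForming

theorem IsKenmotsu.covDerivEnd_deform [T2Space M] (hS : S.IsKenmotsu) (X Y : VField I M) (x : M) :
    covDerivEnd (S.deform a ha).g (S.deform a ha).φ X Y x =
      ((1 / a) * S.g.inner x (S.φ x (X x)) (Y x)) • S.ξ x - S.η x (Y x) • S.φ x (X x) := by
  rw [hS.isTorseForming.covDerivEnd_deform ha X (Y.mdiffAt x), hS X Y x, S.inner_φ_right]
  match_scalars
  · field_simp
    ring
  · ring

end Deform

end AlmostContactMetric

end ContactGeom

open ContactGeom in
theorem mainTheorem11_general {E : Type*} [NormedAddCommGroup E] [NormedSpace ℝ E]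
    [FiniteDimensional ℝ E] {H : Type*} [TopologicalSpace H] {I : ModelWithCorners ℝ E H}
    {M : Type*} [TopologicalSpace M] [ChartedSpace H M] [IsManifold I ∞ M]
    (S : AlmostContactMetric I M) (hS : S.IsTorseForming) (a : ℝ) (ha : 0 < a) :
    (∀ (X Y : Π x : M, TangentSpace I x) (x : M), MDiffAt (T% Y) x →
      covDerivEnd (S.deform a ha).g (S.deform a ha).φ X Y x = covDerivEnd S.g S.φ X Y x +
        ((a - 1) / a * S.g.inner x (X x) (S.φ x (Y x))) • S.ξ x) ∧
    (∀ (x : M) (v : TangentSpace I x),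
      leviCivita (S.deform a ha).g (S.deform a ha).ξ x v = (1 / a) • (v - S.η x v • S.ξ x)) ∧
    (∀ (X Y : Π x : M, TangentSpace I x) (x : M), MDiffAt (T% X) x → MDiffAt (T% Y) x →
      lieDerivMetric (S.deform a ha).g (S.deform a ha).ξ X Y x =
        2 * (S.g.inner x (X x) (Y x) - S.η x (X x) * S.η x (Y x))) ∧
    (∀ x : M, divergence (S.deform a ha).g (S.deform a ha).ξ x =
      (Module.finrank ℝ E - 1) / a) ∧
    (∀ (f : M → ℝ) (x : M), ContMDiffAt I 𝓘(ℝ) 2 f x → ∀ v w : TangentSpace I x,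
      hessian (S.deform a ha).g f x v w = hessian S.g f x v w -
        (a - 1) / a * dirDeriv S.ξ f x * (S.g.inner x v w - S.η x v * S.η x w)) ∧
    (∀ (f : M → ℝ) (x : M), MDiffAt f x →
      grad (S.deform a ha).g f x = (1 / a) • grad S.g f x -
        ((a - 1) / a ^ 2 * dirDeriv S.ξ f x) • S.ξ x) ∧
    (∀ (V : Π x : M, TangentSpace I x) (x : M), MDiffAt (T% V) x →
      divergence (S.deform a ha).g V x = divergence S.g V x) ∧
    (∀ (f : M → ℝ) (x : M), ContMDiffAt I 𝓘(ℝ) 2 f x →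
      laplacian (S.deform a ha).g f x = (1 / a) * laplacian S.g f x -
        (Module.finrank ℝ E - 1) * (a - 1) / a ^ 2 * dirDeriv S.ξ f x -
        (a - 1) / a ^ 2 * dirDeriv S.ξ (dirDeriv S.ξ f) x) :=
  ⟨fun X _ _ hY ↦ hS.covDerivEnd_deform ha X hY,
    hS.leviCivita_deform_deform_ξ ha,
    fun _ _ _ hX hY ↦ hS.lieDerivMetric_deform ha hX hY,
    hS.divergence_deform_ξ ha,
    fun _ _ hf ↦ hS.hessian_deform ha hf,
    fun f x _ ↦ S.grad_deform ha f x,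
    fun _ _ hV ↦ hS.divergence_deform ha hV,
    fun _ _ hf ↦ hS.laplacian_deform ha hf⟩

theorem mainTheorem11 (n : ℕ) {M : Type*} [TopologicalSpace M] [T2Space M]
    [ChartedSpace (EuclideanSpace ℝ (Fin (2 * n + 1))) M] [IsManifold (𝓡 (2 * n + 1)) ∞ M]
    (S : ContactGeom.AlmostContactMetric (𝓡 (2 * n + 1)) M) (hS : S.IsKenmotsu)
    (a : ℝ) (ha : 0 < a) :
    -- the covariant derivative of the deformed `φ`
    (∀ (X Y : ContactGeom.VField (𝓡 (2 * n + 1)) M) (x : M),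
      ContactGeom.covDerivEnd (S.deform a ha).g (S.deform a ha).φ X Y x =
        ((1 / a) * S.g.inner x (S.φ x (X x)) (Y x)) • S.ξ x - S.η x (Y x) • S.φ x (X x)) ∧
    -- the covariant derivative of the deformed `ξ`
    (∀ (x : M) (v : TangentSpace (𝓡 (2 * n + 1)) x),
      ContactGeom.leviCivita (S.deform a ha).g (S.deform a ha).ξ x v = (1 / a) • (v - S.η x v • S.ξ x)) ∧
    -- the Lie derivative of the deformed metric along the deformed `ξ`
    (∀ (X Y : ContactGeom.VField (𝓡 (2 * n + 1)) M) (x : M),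
      ContactGeom.lieDerivMetric (S.deform a ha).g (S.deform a ha).ξ X Y x =
        2 * (S.g.inner x (X x) (Y x) - S.η x (X x) * S.η x (Y x))) ∧
    -- the divergence of the deformed `ξ`
    (∀ x : M, ContactGeom.divergence (S.deform a ha).g (S.deform a ha).ξ x = 2 * n / a) ∧
    -- the Hessian
    (∀ f : M → ℝ, ContMDiff (𝓡 (2 * n + 1)) 𝓘(ℝ) ∞ f →
      ∀ (x : M) (v w : TangentSpace (𝓡 (2 * n + 1)) x),
        ContactGeom.hessian (S.deform a ha).g f x v w =
          ContactGeom.hessian S.g f x v w -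
            (a - 1) / a * ContactGeom.dirDeriv S.ξ f x *
              (S.g.inner x v w - S.η x v * S.η x w)) ∧
    -- the gradient
    (∀ f : M → ℝ, ContMDiff (𝓡 (2 * n + 1)) 𝓘(ℝ) ∞ f → ∀ x : M,
      ContactGeom.grad (S.deform a ha).g f x =
        (1 / a) • ContactGeom.grad S.g f x -
          ((a - 1) / a ^ 2 * ContactGeom.dirDeriv S.ξ f x) • S.ξ x) ∧
    -- the divergence
    (∀ (V : ContactGeom.VField (𝓡 (2 * n + 1)) M) (x : M),
      ContactGeom.divergence (S.deform a ha).g V x = ContactGeom.divergence S.g V x) ∧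
    -- the Laplace operator
    (∀ f : M → ℝ, ContMDiff (𝓡 (2 * n + 1)) 𝓘(ℝ) ∞ f → ∀ x : M,
      ContactGeom.laplacian (S.deform a ha).g f x =
        (1 / a) * ContactGeom.laplacian S.g f x -
          2 * n * (a - 1) / a ^ 2 * ContactGeom.dirDeriv S.ξ f x -
          (a - 1) / a ^ 2 *
            ContactGeom.dirDeriv S.ξ (ContactGeom.dirDeriv S.ξ f) x) := by
  have hn : (Module.finrank ℝ (EuclideanSpace ℝ (Fin (2 * n + 1))) : ℝ) - 1 = 2 * n := by
    simp
  obtain ⟨-, hξ, hLie, hdivξ, hHess, hgrad, hdiv, hΔ⟩ :=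
    hn ▸ mainTheorem11_general S hS.isTorseForming a ha
  exact ⟨hS.covDerivEnd_deform ha, hξ,
    fun X Y x ↦ hLie X Y x (X.mdiffAt x) (Y.mdiffAt x), hdivξ,
    fun f hf x ↦ hHess f x ((hf x).of_le (by norm_cast)),
    fun f hf x ↦ hgrad f x ((hf x).mdifferentiableAt (by simp)),
    fun V x ↦ hdiv V x (V.mdiffAt x),
    fun f hf x ↦ hΔ f x ((hf x).of_le (by norm_cast))⟩
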